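/- For $f\in C([-1,1]^2,\mathbb R)$ let $\|f\|_\infty=\max_{[-1,1]^2}|f|$, and let $T_k$ be the Chebyshev polynomial of the first kind of degree $k$. For an integer $n\ge 1$: * let $\Pi_n^{[t]}$ and $\Pi_n^{[m]}$ be the spaces of real polynomials in two variables of total degree at most $n$ and of maximal degree at most $n$ (degree at most $n$ in each variable), respectively; * let the Padua points of degree $n$ be the self-intersections and the boundary contacts of the curve $\{(x,y)\in[-1,1]^2 : T_n(x)-T_{n+1}(y)=0\}$, that is, the points of the curve at which both partial derivatives of $T_n(x)-T_{n+1}(y)$ vanish and the points of the curve on the boundary of the square; * let the tensor product Chebyshev grid of degree $n$ be $\{(\cos(j\pi/n),\cos(k\pi/n)) : 0\le j,k\le n\}$. **Theorem.** (Total degree) There is a sequence $(\varepsilon_n)_{n\ge1}$ of real numbers with $\varepsilon_n=O(\log^2 n)$ as $n\to\infty$ such that for every $n\ge1$ and every continuous $\alpha:[-1,1]^2\to\mathbb R$: there is exactly one $\alpha_n^{[t]}\in\Pi_n^{[t]}$ that agrees with $\alpha$ at the Padua points of degree $n$, there is a best approximation of $\alpha$ from $\Pi_n^{[t]}$ in $\|\cdot\|_\infty$,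 and every such best approximation $\alpha_n^{[t]\star}$ satisfies $$\|\alpha-\alpha_n^{[t]}\|_\infty\le(1+\varepsilon_n)\,\|\alpha-\alpha_n^{[t]\star}\|_\infty .$$ (Maximal degree) Likewise, there is a sequence $(\varepsilon_n)_{n\ge1}$ with $\varepsilon_n=O(\log^2 n)$ as $n\to\infty$ such that for every $n\ge1$ and every continuous $\alpha:[-1,1]^2\to\mathbb R$: there is exactly one $\alpha_n^{[m]}\in\Pi_n^{[m]}$ that agrees with $\alpha$ on the tensor product Chebyshev grid of degree $n$, there is a best approximation of $\alpha$ from $\Pi_n^{[m]}$ in $\|\cdot\|_\infty$, and every such best approximation $\alpha_n^{[m]\star}$ satisfies $$\|\alpha-\alpha_n^{[m]}\|_\infty\le(1+\varepsilon_n)\,\|\alpha-\alpha_n^{[m]\star}\|_\infty .$$ -/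

import Mathlib

open Filter Asymptotics

noncomputable section

namespace NearBest

/-- The square `[-1,1]²`, with points written as functions `Fin 2 → ℝ`. It is compact, so the norm
on `C(Square, ℝ)` is the sup-norm. -/
abbrev Square : Set (Fin 2 → ℝ) := Set.Icc (fun _ => -1) (fun _ => 1)

/-- The function on the square defined by a bivariate real polynomial. -/
def polyFun (p : MvPolynomial (Fin 2) ℝ) : C(Square, ℝ) where
  toFun ω := MvPolynomial.eval (ω : Fin 2 → ℝ) p
  continuous_toFun := (MvPolynomial.continuous_eval p).comp continuous_subtype_val

/-- The polynomial `T_n(x) - T_{n+1}(y)`, whose zero set in the square is the generating curve of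
the Padua points of degree `n`. -/
def generatingPoly (n : ℕ) : MvPolynomial (Fin 2) ℝ :=
  Polynomial.aeval (MvPolynomial.X 0) (Polynomial.Chebyshev.T ℝ (n : ℤ)) -
    Polynomial.aeval (MvPolynomial.X 1) (Polynomial.Chebyshev.T ℝ ((n : ℤ) + 1))

/-- The point `ω` lies on the generating curve. -/
def OnCurve (n : ℕ) (ω : Fin 2 → ℝ) : Prop :=
  MvPolynomial.eval ω (generatingPoly n) = 0

/-- The curve meets the boundary of the square at `ω`. -/
def IsBoundaryContact (n : ℕ) (ω : Fin 2 → ℝ) : Prop :=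
  OnCurve n ω ∧ ∃ d, |ω d| = 1

/-- The curve crosses itself at `ω`: both first partial derivatives of its equation vanish there.
(At such a point of the square both `T_n` and `T_{n+1}` have an interior extremum with the same
value `1` or `-1`, so the Hessian is indefinite and `ω` is an ordinary double point, at which two
real branches cross.) -/
def IsSelfIntersection (n : ℕ) (ω : Fin 2 → ℝ) : Prop :=
  OnCurve n ω ∧ ∀ d, MvPolynomial.eval ω (MvPolynomial.pderiv d (generatingPoly n)) = 0

/-- The Padua points of degree `n ≥ 1`: the self-intersections and the boundary contacts of the
generating curve `T_n(x) - T_{n+1}(y) = 0` in the square. -/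
def paduaPoints (n : ℕ) : Set Square :=
  {ω | IsSelfIntersection n ω ∨ IsBoundaryContact n ω}

/-- The tensor product Chebyshev grid of degree `n ≥ 1`: both coordinates are among the `n + 1`
Chebyshev points `cos (j π / n)`, `0 ≤ j ≤ n`. -/
def chebyshevGrid (n : ℕ) : Set Square :=
  {ω | ∀ d, ∃ j ≤ n, (ω : Fin 2 → ℝ) d = Polynomial.Chebyshev.node n j}

/-- `p` is an interpolant of `α` on the nodes `X` from the polynomial space `V`. -/
def IsInterpolant (V : Submodule ℝ (MvPolynomial (Fin 2) ℝ)) (X : Set Square) (α : C(Square, ℝ))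
    (p : MvPolynomial (Fin 2) ℝ) : Prop :=
  p ∈ V ∧ ∀ ω ∈ X, polyFun p ω = α ω

/-- `q` is a best sup-norm approximation of `α` from the polynomial space `V`. -/
def IsBestApprox (V : Submodule ℝ (MvPolynomial (Fin 2) ℝ)) (α : C(Square, ℝ))
    (q : MvPolynomial (Fin 2) ℝ) : Prop :=
  q ∈ V ∧ ∀ r ∈ V, ‖α - polyFun q‖ ≤ ‖α - polyFun r‖

/-- Bivariate real polynomials of total degree at most `n`. -/
abbrev totalDegreeSpace (n : ℕ) : Submodule ℝ (MvPolynomial (Fin 2) ℝ) :=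
  MvPolynomial.restrictTotalDegree (Fin 2) ℝ n

/-- Bivariate real polynomials of maximal degree at most `n`, that is, of degree at most `n` in
each variable. -/
abbrev maximalDegreeSpace (n : ℕ) : Submodule ℝ (MvPolynomial (Fin 2) ℝ) :=
  MvPolynomial.restrictDegree (Fin 2) ℝ n

end NearBest

end

/-!
If every polynomial in the space is bounded on the square by `Λ` times its maximum on the nodes,
then the interpolant is unique, and comparing it with a best approximation gives the factor `1 + Λ`;
it exists as soon as there are at most as many nodes as the dimension of the space. So everything
rests on a bound `Λ = O(log² n)`.

Substitute `x = cos s` and `y = cos t`. A cosine polynomial equals the quadrature, over the angles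
of the nodes, of its product with a kernel, so `Λ` is at most the `ℓ¹` norm of the kernel over these
angles. On the Chebyshev grid this works in one variable at a time, with a Dirichlet kernel and a
factor `O(log n)` each time. At the Padua points the average over `j + k` even is the sum of the
plain and the alternating average over all `j` and `k`, and the alternating one vanishes because
all frequencies satisfy `a + b ≤ n`. The kernel is then essentially the Dirichlet kernel of the
triangle `a + b ≤ n`, which is dominated by products of two univariate envelopes
`min N (1 / |sin (u / 2)|)` with `N = n + 1`; each envelope has mean `O(log n)` over equispaced
angles.
-/

noncomputable section

namespace NearBest

open Real Finset

/-! ### Near-best interpolation in finite-dimensional spaces -/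

section Interpolation

variable {𝕜 : Type*} [NontriviallyNormedField 𝕜]

theorem exists_forall_norm_sub_le [LocallyCompactSpace 𝕜] {E : Type*} [NormedAddCommGroup E]
    [NormedSpace 𝕜 E] (W : Submodule 𝕜 E) [FiniteDimensional 𝕜 W] (x : E) :
    ∃ w ∈ W, ∀ v ∈ W, ‖x - w‖ ≤ ‖x - v‖ := by
  have : ProperSpace W := FiniteDimensional.proper 𝕜 W
  have hcoercive : Tendsto (fun w : W => ‖x - w‖) (cocompact W) atTop :=
    tendsto_atTop_mono (fun w => by rw [norm_sub_rev]; exact norm_sub_norm_le (w : E) x)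
      (tendsto_atTop_add_const_right _ (-‖x‖) tendsto_norm_cocompact_atTop)
  obtain ⟨w, hw⟩ := Continuous.exists_forall_le (by fun_prop) hcoercive
  exact ⟨w, w.2, fun v hv => hw ⟨v, hv⟩⟩

variable {K : Type*} [TopologicalSpace K] [CompactSpace K] {W : Submodule 𝕜 C(K, 𝕜)} {X : Set K}
  {Λ : ℝ}

/-- On the function space `W` the sup-norm is controlled by the values on `X`, with constant `Λ`.
If moreover every function on `X` is interpolated from `W`, this says that the Lebesgue constant of
the interpolation is at most `Λ`. -/
def IsNormingSet (W : Submodule 𝕜 C(K, 𝕜)) (X : Set K) (Λ : ℝ) : Prop :=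
  ∀ f ∈ W, ∀ M, (∀ x ∈ X, ‖f x‖ ≤ M) → ‖f‖ ≤ Λ * M

theorem IsNormingSet.norm_sub_le (h : IsNormingSet W X Λ) {α f g : C(K, 𝕜)} (hf : f ∈ W)
    (hg : g ∈ W) (hfα : ∀ x ∈ X, f x = α x) : ‖α - f‖ ≤ (1 + Λ) * ‖α - g‖ := by
  have hgf : ‖g - f‖ ≤ Λ * ‖α - g‖ := h _ (W.sub_mem hg hf) _ fun x hx => by
    rw [ContinuousMap.sub_apply, hfα x hx, norm_sub_rev]
    exact (α - g).norm_coe_le_norm x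
  calc ‖α - f‖ ≤ ‖α - g‖ + ‖g - f‖ := norm_sub_le_norm_sub_add_norm_sub α g f
    _ ≤ (1 + Λ) * ‖α - g‖ := by linarith

theorem IsNormingSet.injOn (h : IsNormingSet W X Λ) :
    Set.InjOn (fun (f : C(K, 𝕜)) (x : X) => f x) W := by
  intro f hf g hg hfg
  have hnorm := h (f - g) (W.sub_mem hf hg) 0 fun x hx => by
    rw [ContinuousMap.sub_apply, sub_eq_zero.2 (congrFun hfg ⟨x, hx⟩), norm_zero]
  rwa [mul_zero, norm_le_zero_iff, sub_eq_zero] at hnorm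

theorem IsNormingSet.existsUnique_interpolant [FiniteDimensional 𝕜 W] (h : IsNormingSet W X Λ)
    (hX : X.Finite) (hcard : X.ncard ≤ Module.finrank 𝕜 W) (α : K → 𝕜) :
    ∃! f, f ∈ W ∧ ∀ x ∈ X, f x = α x := by
  have := hX.fintype
  let restrict : W →ₗ[𝕜] (X → 𝕜) :=
    { toFun := fun f x => f.1 x
      map_add' := fun _ _ => rfl
      map_smul' := fun _ _ => rfl }
  have hinj : Function.Injective restrict := fun f g hfg => Subtype.ext (h.injOn f.2 g.2 hfg)
  have hrank : Module.finrank 𝕜 W = Module.finrank 𝕜 (X → 𝕜) := by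
    refine le_antisymm (LinearMap.finrank_le_finrank_of_injective hinj) ?_
    rwa [Module.finrank_fintype_fun_eq_card, ← Nat.card_eq_fintype_card]
  obtain ⟨f, hf⟩ := (LinearMap.injective_iff_surjective_of_finrank_eq_finrank hrank).1 hinj
    fun x => α x
  refine ⟨f, ⟨f.2, fun x hx => congrFun hf ⟨x, hx⟩⟩, fun g hg => h.injOn hg.1 f.2 ?_⟩
  exact funext fun x => (hg.2 x x.2).trans (congrFun hf x).symm

end Interpolation

/-! ### Equispaced angles -/

/-- The `j`-th of the `2n` equispaced angles `j π / n` on the circle. Their cosines are the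
Chebyshev points `Polynomial.Chebyshev.node n j`. -/
def nodeAngle (n j : ℕ) : ℝ := j * π / n

theorem mul_nodeAngle {n : ℕ} (hn : n ≠ 0) (j : ℕ) : n * nodeAngle n j = j * π := by
  rw [nodeAngle]; field_simp

theorem nodeAngle_add_two_mul {n : ℕ} (hn : n ≠ 0) (j : ℕ) :
    nodeAngle n (j + 2 * n) = nodeAngle n j + 2 * π := by
  rw [nodeAngle, nodeAngle]; push_cast; field_simp

theorem sum_cos_add_mul_nodeAngle {n : ℕ} (hn : n ≠ 0) (m : ℤ) (x : ℝ) :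
    ∑ j ∈ range (2 * n), cos (x + m * nodeAngle n j) =
      if 2 * (n : ℤ) ∣ m then 2 * n * cos x else 0 := by
  split_ifs with h
  · obtain ⟨q, rfl⟩ := h
    have hcos (j : ℕ) : cos (x + (2 * n * q : ℤ) * nodeAngle n j) = cos x := by
      have hangle : (2 * n * q : ℤ) * nodeAngle n j = (q * j : ℤ) * (2 * π) := by
        push_cast; linear_combination 2 * q * mul_nodeAngle hn j
      rw [hangle, cos_add_int_mul_two_pi]
    simp only [hcos, sum_const, card_range, nsmul_eq_mul, Nat.cast_mul, Nat.cast_ofNat]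
  · have hprod := sin_mul_sum_cos (2 * n) (m * π / n) x
    have hperiod : ((2 * n : ℕ) : ℝ) * (m * π / n) / 2 = m * π := by push_cast; field_simp
    rw [hperiod, sin_int_mul_pi, zero_mul, mul_eq_zero] at hprod
    have hsin : sin (m * π / n / 2) ≠ 0 := by
      rw [Ne, sin_eq_zero_iff]
      rintro ⟨q, hq⟩
      refine h ⟨q, ?_⟩
      field_simp at hq
      exact_mod_cast (by linarith : (m : ℝ) = 2 * n * q)
    rw [← hprod.resolve_left hsin]
    exact sum_congr rfl fun j _ => by rw [nodeAngle]; ring_nf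

theorem sum_neg_one_pow_mul_cos_add_mul_nodeAngle {n : ℕ} (hn : n ≠ 0) (m : ℤ) (x : ℝ) :
    ∑ j ∈ range (2 * n), (-1) ^ j * cos (x + m * nodeAngle n j) =
      if 2 * (n : ℤ) ∣ m - n then 2 * n * cos x else 0 := by
  rw [← sum_cos_add_mul_nodeAngle hn (m - n) x]
  refine sum_congr rfl fun j _ => ?_
  rw [← cos_sub_nat_mul_pi]
  congr 1
  push_cast
  linear_combination mul_nodeAngle hn j

theorem cos_mul_cos_mul_add (a b s x : ℝ) : cos (a * x) * cos (b * (s + x)) =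
    1 / 2 * (cos (b * s + (b + a) * x) + cos (b * s + (b - a) * x)) := by
  rw [show b * s + (b + a) * x = b * (s + x) + a * x by ring,
    show b * s + (b - a) * x = b * (s + x) - a * x by ring, cos_add, cos_sub]
  ring

theorem sum_cos_mul_cos_add_nodeAngle {n : ℕ} (hn : n ≠ 0) (a b : ℕ) (s : ℝ) :
    ∑ j ∈ range (2 * n), cos (a * nodeAngle n j) * cos (b * (s + nodeAngle n j)) =
      n * ((if 2 * (n : ℤ) ∣ b + a then 1 else 0) + if 2 * (n : ℤ) ∣ b - a then 1 else 0) *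
        cos (b * s) := by
  have hadd := sum_cos_add_mul_nodeAngle hn (b + a) (b * s)
  have hsub := sum_cos_add_mul_nodeAngle hn (b - a) (b * s)
  push_cast at hadd hsub
  simp only [cos_mul_cos_mul_add, ← mul_sum, sum_add_distrib, hadd, hsub]
  split_ifs <;> ring

theorem sum_neg_one_pow_mul_cos_mul_cos_add_nodeAngle {n : ℕ} (hn : n ≠ 0) {a b : ℕ} (ha : a ≤ n)
    (hb : b ≤ n) (hab : a + b ≠ n) (s : ℝ) :
    ∑ j ∈ range (2 * n),
      (-1) ^ j * cos (a * nodeAngle n j) * cos (b * (s + nodeAngle n j)) = 0 := by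
  have hndvd {m : ℤ} (hm : |m - n| < 2 * n) (hmn : m ≠ n) : ¬ 2 * (n : ℤ) ∣ m - n := fun h =>
    hmn (sub_eq_zero.1 (Int.eq_zero_of_abs_lt_dvd h hm))
  have hadd := sum_neg_one_pow_mul_cos_add_mul_nodeAngle hn (b + a) (b * s)
  have hsub := sum_neg_one_pow_mul_cos_add_mul_nodeAngle hn (b - a) (b * s)
  rw [if_neg (hndvd (by grind) (by omega))] at hadd hsub
  push_cast at hadd hsub
  have hprod (j : ℕ) : (-1) ^ j * cos (a * nodeAngle n j) * cos (b * (s + nodeAngle n j)) =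
      1 / 2 * ((-1) ^ j * cos (b * s + (b + a) * nodeAngle n j) +
        (-1) ^ j * cos (b * s + (b - a) * nodeAngle n j)) := by
    rw [mul_assoc, cos_mul_cos_mul_add]; ring
  simp only [hprod, ← mul_sum, sum_add_distrib, hadd, hsub, add_zero, mul_zero]

/-! ### Dirichlet kernels -/

theorem abs_sum_mul_le {ι : Type*} {s : Finset ι} (f : ι → ℝ) {g : ι → ℝ} {M : ℝ}
    (hg : ∀ i ∈ s, |g i| ≤ M) : |∑ i ∈ s, f i * g i| ≤ (∑ i ∈ s, |f i|) * M := by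
  rw [sum_mul]
  refine (abs_sum_le_sum_abs _ _).trans (sum_le_sum fun i hi => ?_)
  rw [abs_mul]
  exact mul_le_mul_of_nonneg_left (hg i hi) (abs_nonneg _)

/-- The weights `1, 2, 2, …` of the cosine expansion of Dirichlet kernels. -/
def cosWeight (k : ℕ) : ℝ := if k = 0 then 1 else 2

theorem abs_cosWeight_le (k : ℕ) : |cosWeight k| ≤ 2 := by
  rw [cosWeight]; split_ifs <;> norm_num

theorem sum_cosWeight_mul (m : ℕ) (f : ℕ → ℝ) :
    ∑ k ∈ range (m + 1), cosWeight k * f k = 2 * ∑ k ∈ range (m + 1), f k - f 0 := by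
  simp only [sum_range_succ', cosWeight, mul_add, mul_sum, Nat.add_eq_zero_iff, one_ne_zero,
    and_false, if_false, if_true]
  ring

theorem abs_sum_cosWeight_mul_le (m : ℕ) {f : ℕ → ℝ} {A : ℝ} (hf : ∀ k, |f k| ≤ A) :
    |∑ k ∈ range (m + 1), cosWeight k * f k| ≤ 2 * A * (m + 1 : ℕ) := by
  have hA : 0 ≤ A := (abs_nonneg _).trans (hf 0)
  calc |∑ k ∈ range (m + 1), cosWeight k * f k| ≤ (∑ k ∈ range (m + 1), |cosWeight k|) * A :=
        abs_sum_mul_le _ fun k _ => hf k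
    _ ≤ (∑ k ∈ range (m + 1), 2) * A := by gcongr with k; exact abs_cosWeight_le k
    _ = 2 * A * (m + 1 : ℕ) := by rw [sum_const, card_range, nsmul_eq_mul]; ring

/-- A function comparable to `min N (1 / |sin (u / 2)|)`, the envelope of the Dirichlet kernels of
degree less than `N`. -/
def peak (N : ℕ) (u : ℝ) : ℝ := N / (1 + N * |sin (u / 2)|)

theorem peak_nonneg (N : ℕ) (u : ℝ) : 0 ≤ peak N u := by
  rw [peak]; positivity

theorem peak_periodic (N : ℕ) : Function.Periodic (peak N) (2 * π) := by
  intro u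
  rw [peak, peak, add_div, mul_div_cancel_left₀ _ two_ne_zero, sin_add_pi, abs_neg]

theorem le_mul_peak {N : ℕ} {x A B u : ℝ} (hN : x ≤ A * N) (hsin : x * |sin (u / 2)| ≤ B) :
    x ≤ (A + B) * peak N u := by
  rw [peak, mul_div_assoc', le_div_iff₀ (by positivity)]
  nlinarith [mul_le_mul_of_nonneg_left hsin (Nat.cast_nonneg (α := ℝ) N)]

theorem abs_sum_cos_mul_abs_sin_le (m : ℕ) (u β : ℝ) :
    |∑ k ∈ range m, cos (u * k + β)| * |sin (u / 2)| ≤ 1 := by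
  rw [mul_comm, ← abs_mul, sin_mul_sum_cos, abs_mul]
  exact mul_le_one₀ (abs_sin_le_one _) (abs_nonneg _) (abs_cos_le_one _)

theorem abs_sum_cosWeight_mul_cos_le {m N : ℕ} (hmN : m + 1 ≤ N) (u β : ℝ) :
    |∑ k ∈ range (m + 1), cosWeight k * cos (u * k + β)| ≤ 5 * peak N u := by
  have hN : |∑ k ∈ range (m + 1), cosWeight k * cos (u * k + β)| ≤ 2 * N := by
    refine (abs_sum_cosWeight_mul_le m fun k => abs_cos_le_one (u * k + β)).trans ?_
    rw [mul_one]; gcongr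
  have hsin : |∑ k ∈ range (m + 1), cosWeight k * cos (u * k + β)| * |sin (u / 2)| ≤ 3 := by
    rw [sum_cosWeight_mul m fun k => cos (u * k + β)]
    calc |2 * ∑ k ∈ range (m + 1), cos (u * k + β) - cos (u * (0 : ℕ) + β)| * |sin (u / 2)|
        ≤ (|2 * ∑ k ∈ range (m + 1), cos (u * k + β)| + |cos (u * (0 : ℕ) + β)|) *
            |sin (u / 2)| := by gcongr; exact abs_sub _ _
      _ = 2 * (|∑ k ∈ range (m + 1), cos (u * k + β)| * |sin (u / 2)|) +
            |cos (u * (0 : ℕ) + β)| * |sin (u / 2)| := by rw [abs_mul, abs_two]; ring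
      _ ≤ 2 * 1 + 1 := add_le_add
          (mul_le_mul_of_nonneg_left (abs_sum_cos_mul_abs_sin_le _ _ _) zero_le_two)
          (mul_le_one₀ (abs_cos_le_one _) (abs_nonneg _) (abs_sin_le_one _))
      _ = 3 := by norm_num
  convert le_mul_peak hN hsin using 2
  norm_num

/-- The univariate Dirichlet kernel. -/
def dirichletKernel (m : ℕ) (s : ℝ) : ℝ := ∑ k ∈ range (m + 1), cosWeight k * cos (k * s)

theorem abs_dirichletKernel_le {m N : ℕ} (hmN : m + 1 ≤ N) (s : ℝ) :
    |dirichletKernel m s| ≤ 5 * peak N s := by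
  simpa only [dirichletKernel, add_zero, mul_comm s] using abs_sum_cosWeight_mul_cos_le hmN s 0

theorem dirichletKernel_mul_sin (m : ℕ) (s : ℝ) :
    dirichletKernel m s * sin (s / 2) = sin ((m + 1 / 2) * s) := by
  have hsum := sin_mul_sum_cos (m + 1) s 0
  have hsin : sin ((m + 1 / 2) * s) + sin (s / 2) =
      2 * sin ((m + 1 : ℕ) * s / 2) * cos (((m + 1 : ℕ) - 1) * s / 2 + 0) := by
    rw [two_mul_sin_mul_cos]; push_cast; ring_nf
  rw [dirichletKernel, sum_cosWeight_mul m fun k => cos (k * s)]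
  simp only [add_zero, mul_comm s, Nat.cast_zero, zero_mul, cos_zero] at hsum hsin ⊢
  linear_combination 2 * hsum - hsin

/-! ### Kernels of the triangle -/

/-- The frequencies `(a, b)` with `a + b ≤ n`. -/
def triangle (n : ℕ) : Finset (ℕ × ℕ) :=
  (range (n + 1) ×ˢ range (n + 2)).filter fun x => x.1 + x.2 ≤ n

theorem mem_triangle {n : ℕ} {x : ℕ × ℕ} : x ∈ triangle n ↔ x.1 + x.2 ≤ n := by
  simp only [triangle, mem_filter, mem_product, mem_range]; omega

theorem sum_triangle {M : Type*} [AddCommMonoid M] (n : ℕ) (f : ℕ → ℕ → M) :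
    ∑ x ∈ triangle n, f x.1 x.2 = ∑ a ∈ range (n + 1), ∑ b ∈ range (n - a + 1), f a b :=
  sum_finset_product' _ _ _ (f := f) fun x => by simp only [mem_triangle, mem_range]; omega

theorem sum_triangle_swap {M : Type*} [AddCommMonoid M] (n : ℕ) (f : ℕ → ℕ → M) :
    ∑ x ∈ triangle n, f x.2 x.1 = ∑ x ∈ triangle n, f x.1 x.2 :=
  sum_equiv (Equiv.prodComm ℕ ℕ) (fun x => by simp [mem_triangle, add_comm]) fun _ _ => rfl

/-- The bivariate Dirichlet kernel of the triangle `a + b ≤ n`. -/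
def triangleKernel (n : ℕ) (s t : ℝ) : ℝ :=
  ∑ x ∈ triangle n, cosWeight x.1 * cos (x.1 * s) * (cosWeight x.2 * cos (x.2 * t))

theorem triangleKernel_comm (n : ℕ) (s t : ℝ) : triangleKernel n s t = triangleKernel n t s := by
  rw [triangleKernel, triangleKernel, ← sum_triangle_swap n fun a b =>
    cosWeight a * cos (a * s) * (cosWeight b * cos (b * t))]
  exact sum_congr rfl fun _ _ => mul_comm _ _

theorem triangleKernel_eq_sum_dirichletKernel (n : ℕ) (s t : ℝ) : triangleKernel n s t =
    ∑ a ∈ range (n + 1), cosWeight a * (cos (a * s) * dirichletKernel (n - a) t) := by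
  rw [triangleKernel, sum_triangle n fun a b =>
    cosWeight a * cos (a * s) * (cosWeight b * cos (b * t))]
  simp only [dirichletKernel, mul_sum, mul_assoc]

theorem abs_triangleKernel_le_mul (n : ℕ) (s t : ℝ) :
    |triangleKernel n s t| ≤ 10 * peak (n + 1) s * (n + 1 : ℕ) := by
  have hterm (b : ℕ) : |cos (b * t) * dirichletKernel (n - b) s| ≤ 5 * peak (n + 1) s := by
    rw [abs_mul, ← one_mul (5 * _)]
    exact mul_le_mul (abs_cos_le_one _) (abs_dirichletKernel_le (by omega) s) (abs_nonneg _)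
      zero_le_one
  rw [triangleKernel_comm, triangleKernel_eq_sum_dirichletKernel]
  exact (abs_sum_cosWeight_mul_le n hterm).trans_eq (by ring)

theorem triangleKernel_mul_sin (n : ℕ) (s t : ℝ) : triangleKernel n s t * sin (t / 2) =
    1 / 2 * (∑ a ∈ range (n + 1), cosWeight a * cos ((s - t) * a + ((n + 1 / 2) * t - π / 2)) -
      ∑ a ∈ range (n + 1), cosWeight a * cos ((s + t) * a + (-(n + 1 / 2) * t - π / 2))) := by
  rw [triangleKernel_eq_sum_dirichletKernel, sum_mul, ← sum_sub_distrib, mul_sum]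
  refine sum_congr rfl fun a ha => ?_
  have hdirichlet := dirichletKernel_mul_sin (n - a) t
  rw [Nat.cast_sub (mem_range_succ_iff.1 ha)] at hdirichlet
  have hminus : cos ((s - t) * a + ((n + 1 / 2) * t - π / 2)) =
      sin (a * s + (n - a + 1 / 2) * t) := by rw [← cos_sub_pi_div_two]; ring_nf
  have hplus : cos ((s + t) * a + (-(n + 1 / 2) * t - π / 2)) =
      sin (a * s - (n - a + 1 / 2) * t) := by rw [← cos_sub_pi_div_two]; ring_nf
  rw [hminus, hplus, sin_add, sin_sub]
  linear_combination cosWeight a * cos (a * s) * hdirichlet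

theorem abs_triangleKernel_mul_abs_sin_le (n : ℕ) (s t : ℝ) :
    |triangleKernel n s t| * |sin (t / 2)| ≤
      5 / 2 * (peak (n + 1) (s - t) + peak (n + 1) (s + t)) := by
  rw [← abs_mul, triangleKernel_mul_sin, abs_mul, abs_of_pos one_half_pos]
  calc _ ≤ 1 / 2 * (5 * peak (n + 1) (s - t) + 5 * peak (n + 1) (s + t)) := by
        gcongr
        exact (abs_sub _ _).trans (add_le_add (abs_sum_cosWeight_mul_cos_le le_rfl _ _)
          (abs_sum_cosWeight_mul_cos_le le_rfl _ _))
    _ = _ := by ring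

theorem abs_triangleKernel_le (n : ℕ) (s t : ℝ) : |triangleKernel n s t| ≤
    10 * (peak (n + 1) s + peak (n + 1) (s - t) + peak (n + 1) (s + t)) * peak (n + 1) t := by
  refine (le_mul_peak (abs_triangleKernel_le_mul n s t)
    (abs_triangleKernel_mul_abs_sin_le n s t)).trans ?_
  refine mul_le_mul_of_nonneg_right ?_ (peak_nonneg _ _)
  linarith [peak_nonneg (n + 1) (s - t), peak_nonneg (n + 1) (s + t)]

/-! ### Logarithmic bounds for sums over equispaced angles -/

theorem periodic_sum_add_nodeAngle {f : ℝ → ℝ} (hf : Function.Periodic f (2 * π)) {n : ℕ}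
    (hn : n ≠ 0) :
    Function.Periodic (fun c => ∑ j ∈ range (2 * n), f (c + nodeAngle n j)) (π / n) := by
  intro c
  have hshift (j : ℕ) : c + π / n + nodeAngle n j = c + nodeAngle n (j + 1) := by
    rw [nodeAngle, nodeAngle]; push_cast; ring
  have hwrap : f (c + nodeAngle n (2 * n)) = f (c + nodeAngle n 0) := by
    rw [← zero_add (2 * n), nodeAngle_add_two_mul hn, ← add_assoc, hf]
  have hlast := sum_range_succ (fun j => f (c + nodeAngle n j)) (2 * n)
  have hfirst := sum_range_succ' (fun j => f (c + nodeAngle n j)) (2 * n)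
  simp only [hshift]
  linarith

theorem peak_le_div {n N i : ℕ} (hn : n ≠ 0) (hnN : n ≤ N) {u : ℝ} (hi : i * (π / n) ≤ |u|)
    (hu : |u| ≤ π) : peak N u ≤ N / (i + 1) := by
  have hsin : |u| / π ≤ |sin (u / 2)| := by
    have hjordan := mul_abs_le_abs_sin (x := u / 2) (by rw [abs_div, abs_two]; gcongr)
    rw [abs_div, abs_two] at hjordan
    exact le_of_eq_of_le (by ring) hjordan
  have hle : (i : ℝ) ≤ N * |sin (u / 2)| :=
    calc (i : ℝ) = n * (i * (π / n) / π) := by field_simp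
      _ ≤ N * |sin (u / 2)| := by gcongr; exact le_trans (by gcongr) hsin
  rw [peak, add_comm]
  gcongr

theorem peak_add_nodeAngle_le {n N j : ℕ} (hn : n ≠ 0) (hnN : n ≤ N) (hj : j < 2 * n) {c : ℝ}
    (hc : c ∈ Set.Ico 0 (π / n)) :
    peak N (c + nodeAngle n j) ≤ N / (j + 1) + N / ((2 * n - 1 - j : ℕ) + 1) := by
  set u := c + nodeAngle n j with hu
  have hlower : j * (π / n) ≤ u := by rw [hu, nodeAngle]; linarith [hc.1, mul_div_assoc (j : ℝ) π n]
  have hupper : (2 * n - 1 - j : ℕ) * (π / n) ≤ 2 * π - u := by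
    have hfull : 2 * n * (π / n) = 2 * π := by field_simp
    rw [Nat.sub_sub, Nat.cast_sub (by omega), hu, nodeAngle]
    push_cast
    linarith [hc.2, mul_div_assoc (j : ℝ) π n]
  have hu0 : 0 ≤ u := le_trans (by positivity) hlower
  have hu2 : 0 ≤ 2 * π - u := le_trans (by positivity) hupper
  rcases le_total u π with h | h
  · refine (peak_le_div hn hnN ?_ ?_).trans (le_add_of_nonneg_right (by positivity)) <;>
      rwa [abs_of_nonneg hu0]
  · rw [← (peak_periodic N).sub_eq u]
    refine (peak_le_div hn hnN ?_ ?_).trans (le_add_of_nonneg_left (by positivity)) <;>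
      rw [abs_sub_comm, abs_of_nonneg hu2]
    · exact hupper
    · linarith

/-- The logarithmic factor in the bounds for the Lebesgue constants of degree `n`. -/
def logFactor (n : ℕ) : ℝ := 1 + log (2 * (n + 1))

theorem one_le_logFactor (n : ℕ) : 1 ≤ logFactor n :=
  le_add_of_nonneg_right (log_nonneg (by linarith [Nat.cast_nonneg (α := ℝ) n]))

theorem sum_inv_succ_le_logFactor {m n : ℕ} (hmn : m ≤ 2 * (n + 1)) :
    ∑ i ∈ range m, ((i : ℝ) + 1)⁻¹ ≤ logFactor n := by
  rcases Nat.eq_zero_or_pos m with rfl | hm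
  · exact zero_le_one.trans (one_le_logFactor n)
  calc ∑ i ∈ range m, ((i : ℝ) + 1)⁻¹ = (harmonic m : ℝ) := by simp [harmonic]
    _ ≤ 1 + log m := harmonic_le_one_add_log m
    _ ≤ logFactor n := by rw [logFactor]; gcongr; exact_mod_cast hmn

theorem sum_peak_le {m n : ℕ} (hm : m ≠ 0) (hmn : m ≤ n + 1) (c : ℝ) :
    ∑ j ∈ range (2 * m), peak (n + 1) (c + nodeAngle m j) ≤ 2 * (n + 1) * logFactor n := by
  obtain ⟨d, hd, hcd⟩ := (periodic_sum_add_nodeAngle (peak_periodic (n + 1)) hm).exists_mem_Ico₀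
    (by positivity) c
  calc ∑ j ∈ range (2 * m), peak (n + 1) (c + nodeAngle m j)
      = ∑ j ∈ range (2 * m), peak (n + 1) (d + nodeAngle m j) := hcd
    _ ≤ ∑ j ∈ range (2 * m), (((n + 1 : ℕ) : ℝ) / (j + 1) +
          (n + 1 : ℕ) / ((2 * m - 1 - j : ℕ) + 1)) :=
        sum_le_sum fun j hj => peak_add_nodeAngle_le hm hmn (mem_range.1 hj) hd
    _ = 2 * (n + 1) * ∑ j ∈ range (2 * m), ((j : ℝ) + 1)⁻¹ := by
        rw [sum_add_distrib, sum_range_reflect (fun i : ℕ => ((n + 1 : ℕ) : ℝ) / (i + 1))]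
        simp only [div_eq_mul_inv, ← mul_sum]
        push_cast
        ring
    _ ≤ 2 * (n + 1) * logFactor n := by gcongr; exact sum_inv_succ_le_logFactor (by omega)

theorem sum_abs_triangleKernel_le {l m n : ℕ} (hl : l ≠ 0) (hln : l ≤ n + 1) (hm : m ≠ 0)
    (hmn : m ≤ n + 1) (s t : ℝ) :
    ∑ j ∈ range (2 * l), ∑ k ∈ range (2 * m),
        |triangleKernel n (s + nodeAngle l j) (t + nodeAngle m k)| ≤
      120 * ((n + 1) * logFactor n) ^ 2 := by
  have hinner (v : ℝ) : ∑ j ∈ range (2 * l), |triangleKernel n (s + nodeAngle l j) v| ≤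
      60 * (n + 1) * logFactor n * peak (n + 1) v := by
    refine (sum_le_sum fun j _ => abs_triangleKernel_le n (s + nodeAngle l j) v).trans ?_
    simp only [← sum_mul, ← mul_sum, sum_add_distrib, add_sub_right_comm s, add_right_comm s _ v]
    refine mul_le_mul_of_nonneg_right ?_ (peak_nonneg _ _)
    linarith [sum_peak_le hl hln s, sum_peak_le hl hln (s - v), sum_peak_le hl hln (s + v)]
  rw [sum_comm]
  calc _ ≤ ∑ k ∈ range (2 * m), 60 * (n + 1) * logFactor n * peak (n + 1) (t + nodeAngle m k) :=
        sum_le_sum fun k _ => hinner _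
    _ ≤ 60 * (n + 1) * logFactor n * (2 * (n + 1) * logFactor n) := by
        rw [← mul_sum]
        have := one_le_logFactor n
        exact mul_le_mul_of_nonneg_left (sum_peak_le hm hmn t) (by positivity)
    _ = 120 * ((n + 1) * logFactor n) ^ 2 := by ring

/-! ### Reproducing kernels for cosine polynomials -/

/-- The cosine polynomials `∑ a ≤ n, c a * cos (a s)`. -/
def cosSpan (n : ℕ) : Submodule ℝ (ℝ → ℝ) :=
  Submodule.span ℝ ((fun (a : ℕ) s => cos (a * s)) '' Set.Iic n)

/-- The bivariate cosine polynomials `∑ a + b ≤ n, c a b * cos (a s) * cos (b t)`. -/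
def cosSpan₂ (n : ℕ) : Submodule ℝ (ℝ → ℝ → ℝ) :=
  Submodule.span ℝ ((fun (x : ℕ × ℕ) s t => cos (x.1 * s) * cos (x.2 * t)) '' triangle n)

/-- The weights which make the cosines of frequency at most `n` orthonormal on the angles
`nodeAngle n`. They differ from `cosWeight` at the frequency `n`, where `cos (n s) = ±1` on all of
these angles. -/
def gridWeight (n a : ℕ) : ℝ := if a = 0 ∨ a = n then 1 else 2

theorem cosWeight_eq_gridWeight {n b : ℕ} (hb : b ≠ n) : cosWeight b = gridWeight n b := by
  simp only [cosWeight, gridWeight, hb, or_false]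

theorem cosWeight_sub_gridWeight {n : ℕ} (hn : n ≠ 0) (a : ℕ) :
    cosWeight a - gridWeight n a = if a = n then 1 else 0 := by
  rw [cosWeight, gridWeight]
  split_ifs <;> first | omega | norm_num

theorem gridWeight_mul_sum_cos_mul_cos {n a b : ℕ} (hn : n ≠ 0) (ha : a ≤ n) (hb : b ≤ n) (s : ℝ) :
    gridWeight n b * ∑ j ∈ range (2 * n), cos (a * nodeAngle n j) * cos (b * (s + nodeAngle n j)) =
      if b = a then 2 * n * cos (b * s) else 0 := by
  have hsub : 2 * (n : ℤ) ∣ b - a ↔ b = a := by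
    refine ⟨fun h => ?_, fun h => by simp [h]⟩
    have := Int.eq_zero_of_abs_lt_dvd h (by grind)
    omega
  have hadd : 2 * (n : ℤ) ∣ b + a ↔ b = a ∧ (b = 0 ∨ b = n) := by
    constructor
    · intro h
      rcases eq_or_ne (b + a) 0 with h0 | h0
      · omega
      · have := Int.le_of_dvd (by omega) h
        omega
    · rintro ⟨rfl, rfl | rfl⟩ <;> simp [two_mul]
  simp only [sum_cos_mul_cos_add_nodeAngle hn, hsub, hadd, gridWeight]
  split_ifs <;> first | omega | ring

/-- The reproducing kernel of `cosSpan n` on the angles `nodeAngle n`. -/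
def gridKernel (n : ℕ) (s : ℝ) : ℝ := ∑ a ∈ range (n + 1), gridWeight n a * cos (a * s)

theorem gridKernel_eq {n : ℕ} (hn : n ≠ 0) (s : ℝ) :
    gridKernel n s = dirichletKernel n s - cos (n * s) := by
  rw [eq_sub_iff_add_eq', ← eq_sub_iff_add_eq, dirichletKernel, gridKernel, ← sum_sub_distrib]
  simp only [← sub_mul, cosWeight_sub_gridWeight hn, ite_mul, one_mul, zero_mul]
  rw [sum_ite_eq' (range (n + 1)), if_pos (self_mem_range_succ n)]

theorem sum_mul_gridKernel {n : ℕ} (hn : n ≠ 0) {f : ℝ → ℝ} (hf : f ∈ cosSpan n) (s : ℝ) :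
    ∑ j ∈ range (2 * n), gridKernel n (s + nodeAngle n j) * f (nodeAngle n j) = 2 * n * f s := by
  let evalₗ (u : ℝ) : (ℝ → ℝ) →ₗ[ℝ] ℝ := LinearMap.proj u
  let quadrature : (ℝ → ℝ) →ₗ[ℝ] ℝ :=
    ∑ j ∈ range (2 * n), gridKernel n (s + nodeAngle n j) • evalₗ (nodeAngle n j)
  have hcos : Set.EqOn quadrature ((2 * n : ℝ) • evalₗ s : (ℝ → ℝ) →ₗ[ℝ] ℝ)
      ((fun (a : ℕ) s => cos (a * s)) '' Set.Iic n) := by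
    rintro _ ⟨a, ha, rfl⟩
    simp only [quadrature, evalₗ, LinearMap.sum_apply, LinearMap.smul_apply, LinearMap.proj_apply,
      smul_eq_mul, gridKernel, sum_mul]
    rw [sum_comm]
    simp only [mul_assoc, ← mul_sum, mul_comm (cos (_ * (s + _)))]
    rw [sum_congr rfl fun b hb =>
      gridWeight_mul_sum_cos_mul_cos hn ha (mem_range_succ_iff.1 hb) s, sum_ite_eq',
      if_pos (mem_range_succ_iff.2 ha), mul_assoc]
  simpa [quadrature, evalₗ] using LinearMap.eqOn_span hcos hf

/-- The reproducing kernel of `cosSpan₂ n` on the pairs of angles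
`(nodeAngle n j, nodeAngle (n + 1) k)` with `j + k` even. -/
def paduaKernel (n : ℕ) (s t : ℝ) : ℝ :=
  ∑ x ∈ triangle n, gridWeight n x.1 * cos (x.1 * s) * (cosWeight x.2 * cos (x.2 * t))

theorem paduaKernel_eq {n : ℕ} (hn : n ≠ 0) (s t : ℝ) :
    paduaKernel n s t = triangleKernel n s t - cos (n * s) := by
  have hdiff : triangleKernel n s t - paduaKernel n s t = cos (n * s) := by
    rw [triangleKernel, paduaKernel, ← sum_sub_distrib]
    simp only [← sub_mul, cosWeight_sub_gridWeight hn]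
    rw [sum_eq_single_of_mem (n, 0) (mem_triangle.2 (by simp))]
    · simp [cosWeight]
    · rintro ⟨a, b⟩ hab hne
      rw [mem_triangle] at hab
      rw [if_neg (by grind), zero_mul, zero_mul]
  linarith

theorem sum_sum_mul_paduaKernel (n : ℕ) (J K : Finset ℕ) (f g u v : ℕ → ℝ) :
    ∑ j ∈ J, ∑ k ∈ K, f j * g k * paduaKernel n (u j) (v k) =
      ∑ x ∈ triangle n, gridWeight n x.1 * (∑ j ∈ J, f j * cos (x.1 * u j)) *
        (cosWeight x.2 * ∑ k ∈ K, g k * cos (x.2 * v k)) := by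
  simp only [paduaKernel, mul_sum (triangle n), sum_comm (s := K) (t := triangle n)]
  rw [sum_comm]
  refine sum_congr rfl fun x _ => ?_
  rw [mul_sum, mul_sum, sum_mul_sum]
  exact sum_congr rfl fun j _ => sum_congr rfl fun k _ => by ring

theorem sum_sum_cos_mul_paduaKernel {n a b : ℕ} (hn : n ≠ 0) (hab : a + b ≤ n) (s t : ℝ) :
    ∑ j ∈ range (2 * n), ∑ k ∈ range (2 * (n + 1)),
      cos (a * nodeAngle n j) * cos (b * nodeAngle (n + 1) k) *
        paduaKernel n (s + nodeAngle n j) (t + nodeAngle (n + 1) k) =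
      4 * n * (n + 1) * (cos (a * s) * cos (b * t)) := by
  rw [sum_sum_mul_paduaKernel n _ _ (fun j => cos (a * nodeAngle n j))
    (fun k => cos (b * nodeAngle (n + 1) k)) (fun j => s + nodeAngle n j)
    (fun k => t + nodeAngle (n + 1) k), sum_eq_single (a, b)]
  · rw [cosWeight_eq_gridWeight (n := n + 1) (by omega),
      gridWeight_mul_sum_cos_mul_cos hn (by omega) (by omega),
      gridWeight_mul_sum_cos_mul_cos n.succ_ne_zero (by omega) (by omega), if_pos rfl, if_pos rfl]
    push_cast
    ring
  · rintro ⟨c, d⟩ hcd hne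
    rw [mem_triangle] at hcd
    rw [cosWeight_eq_gridWeight (n := n + 1) (by omega),
      gridWeight_mul_sum_cos_mul_cos hn (by omega) (by omega),
      gridWeight_mul_sum_cos_mul_cos n.succ_ne_zero (by omega) (by omega)]
    have hne' : c ≠ a ∨ d ≠ b := by rwa [Ne, Prod.mk.injEq, not_and_or] at hne
    rcases hne' with h | h
    · rw [if_neg h, zero_mul]
    · rw [if_neg (c := d = b) h, mul_zero]
  · exact fun h => absurd (mem_triangle.2 hab) h

theorem sum_sum_neg_one_pow_mul_cos_mul_paduaKernel {n a b : ℕ} (hn : n ≠ 0) (hab : a + b ≤ n)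
    (s t : ℝ) :
    ∑ j ∈ range (2 * n), ∑ k ∈ range (2 * (n + 1)),
      (-1) ^ j * cos (a * nodeAngle n j) * ((-1) ^ k * cos (b * nodeAngle (n + 1) k)) *
        paduaKernel n (s + nodeAngle n j) (t + nodeAngle (n + 1) k) = 0 := by
  rw [sum_sum_mul_paduaKernel n _ _ (fun j => (-1) ^ j * cos (a * nodeAngle n j))
    (fun k => (-1) ^ k * cos (b * nodeAngle (n + 1) k)) (fun j => s + nodeAngle n j)
    (fun k => t + nodeAngle (n + 1) k)]
  refine sum_eq_zero fun x hx => ?_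
  rw [mem_triangle] at hx
  -- `(a, b)` and `x` lie in the triangle, so `a + x.1 = n` and `b + x.2 = n + 1` cannot both hold,
  -- and one of the two univariate alternating sums vanishes.
  rcases ne_or_eq (a + x.1) n with h | h
  · rw [sum_neg_one_pow_mul_cos_mul_cos_add_nodeAngle hn (by omega) (by omega) h, mul_zero,
      zero_mul]
  · rw [sum_neg_one_pow_mul_cos_mul_cos_add_nodeAngle n.succ_ne_zero (by omega) (by omega)
      (by omega : b + x.2 ≠ n + 1), mul_zero, mul_zero]

/-- The pairs `(j, k)` with `j + k` even for which the angles `(nodeAngle n j, nodeAngle (n + 1) k)`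
run once through the torus. Their cosines are the Padua points, most of them counted four times. -/
def paduaIndex (n : ℕ) : Finset (ℕ × ℕ) :=
  (range (2 * n) ×ˢ range (2 * (n + 1))).filter fun x => Even (x.1 + x.2)

theorem two_mul_sum_paduaIndex (n : ℕ) (F : ℕ → ℕ → ℝ) :
    2 * ∑ x ∈ paduaIndex n, F x.1 x.2 = ∑ j ∈ range (2 * n), ∑ k ∈ range (2 * (n + 1)), F j k +
      ∑ j ∈ range (2 * n), ∑ k ∈ range (2 * (n + 1)), (-1) ^ j * (-1) ^ k * F j k := by
  simp only [paduaIndex, sum_filter, mul_sum, sum_product, ← sum_add_distrib, ← pow_add]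
  refine sum_congr rfl fun j _ => sum_congr rfl fun k _ => ?_
  rcases Nat.even_or_odd (j + k) with h | h
  · rw [if_pos h, h.neg_one_pow]; ring
  · rw [if_neg (Nat.not_even_iff_odd.2 h), h.neg_one_pow]; ring

theorem sum_mul_paduaKernel {n : ℕ} (hn : n ≠ 0) {f : ℝ → ℝ → ℝ} (hf : f ∈ cosSpan₂ n)
    (s t : ℝ) :
    ∑ x ∈ paduaIndex n, paduaKernel n (s + nodeAngle n x.1) (t + nodeAngle (n + 1) x.2) *
      f (nodeAngle n x.1) (nodeAngle (n + 1) x.2) = 2 * n * (n + 1) * f s t := by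
  let evalₗ (u v : ℝ) : (ℝ → ℝ → ℝ) →ₗ[ℝ] ℝ := LinearMap.proj v ∘ₗ LinearMap.proj u
  let quadrature : (ℝ → ℝ → ℝ) →ₗ[ℝ] ℝ :=
    ∑ x ∈ paduaIndex n, paduaKernel n (s + nodeAngle n x.1) (t + nodeAngle (n + 1) x.2) •
      evalₗ (nodeAngle n x.1) (nodeAngle (n + 1) x.2)
  have hcos : Set.EqOn quadrature ((2 * n * (n + 1) : ℝ) • evalₗ s t : (ℝ → ℝ → ℝ) →ₗ[ℝ] ℝ)
      ((fun (x : ℕ × ℕ) s t => cos (x.1 * s) * cos (x.2 * t)) '' triangle n) := by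
    rintro _ ⟨⟨a, b⟩, hab, rfl⟩
    have hall := sum_sum_cos_mul_paduaKernel hn (mem_triangle.1 hab) s t
    have halt := sum_sum_neg_one_pow_mul_cos_mul_paduaKernel hn (mem_triangle.1 hab) s t
    have heven := two_mul_sum_paduaIndex n fun j k =>
      paduaKernel n (s + nodeAngle n j) (t + nodeAngle (n + 1) k) *
        (cos (a * nodeAngle n j) * cos (b * nodeAngle (n + 1) k))
    simp only [mul_comm (paduaKernel _ _ _), hall, ← mul_assoc] at heven
    simp only [mul_right_comm _ ((-1 : ℝ) ^ _) (cos _), ← mul_assoc] at halt heven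
    simp only [quadrature, evalₗ, LinearMap.sum_apply, LinearMap.smul_apply, LinearMap.comp_apply,
      LinearMap.proj_apply, smul_eq_mul, mul_comm (paduaKernel _ _ _)]
    linarith
  simpa [quadrature, evalₗ] using LinearMap.eqOn_span hcos hf

/-! ### Bounds by the values at the nodes -/

theorem abs_gridKernel_le {n : ℕ} (hn : n ≠ 0) (s : ℝ) :
    |gridKernel n s| ≤ 5 * peak (n + 1) s + 1 := by
  rw [gridKernel_eq hn]
  exact (abs_sub _ _).trans (add_le_add (abs_dirichletKernel_le le_rfl s) (abs_cos_le_one _))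

theorem sum_abs_gridKernel_le {n : ℕ} (hn : n ≠ 0) (s : ℝ) :
    ∑ j ∈ range (2 * n), |gridKernel n (s + nodeAngle n j)| ≤ 2 * n * (11 * logFactor n) := by
  have hn1 : (1 : ℝ) ≤ n := by exact_mod_cast Nat.one_le_iff_ne_zero.2 hn
  calc _ ≤ ∑ j ∈ range (2 * n), (5 * peak (n + 1) (s + nodeAngle n j) + 1) :=
        sum_le_sum fun j _ => abs_gridKernel_le hn _
    _ = 5 * ∑ j ∈ range (2 * n), peak (n + 1) (s + nodeAngle n j) + 2 * n := by
        simp [sum_add_distrib, mul_sum]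
    _ ≤ 5 * (2 * (n + 1) * logFactor n) + 2 * n := by gcongr; exact sum_peak_le hn (by omega) s
    _ ≤ 2 * n * (11 * logFactor n) := by nlinarith [one_le_logFactor n]

theorem abs_le_of_mem_cosSpan {n : ℕ} (hn : n ≠ 0) {f : ℝ → ℝ} (hf : f ∈ cosSpan n) {M : ℝ}
    (hM : ∀ j, |f (nodeAngle n j)| ≤ M) (s : ℝ) : |f s| ≤ 11 * logFactor n * M := by
  have hpos : (0 : ℝ) < 2 * n := by positivity
  have hM0 : 0 ≤ M := (abs_nonneg _).trans (hM 0)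
  refine le_of_mul_le_mul_left ?_ hpos
  calc 2 * n * |f s| = |∑ j ∈ range (2 * n), gridKernel n (s + nodeAngle n j) *
        f (nodeAngle n j)| := by rw [sum_mul_gridKernel hn hf, abs_mul, abs_of_pos hpos]
    _ ≤ (∑ j ∈ range (2 * n), |gridKernel n (s + nodeAngle n j)|) * M :=
        abs_sum_mul_le _ fun j _ => hM j
    _ ≤ 2 * n * (11 * logFactor n) * M := by gcongr; exact sum_abs_gridKernel_le hn s
    _ = 2 * n * (11 * logFactor n * M) := mul_assoc _ _ _

theorem abs_paduaKernel_le {n : ℕ} (hn : n ≠ 0) (s t : ℝ) :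
    |paduaKernel n s t| ≤ |triangleKernel n s t| + 1 := by
  rw [paduaKernel_eq hn]
  exact (abs_sub _ _).trans (add_le_add_right (abs_cos_le_one _) _)

theorem sum_abs_paduaKernel_le {n : ℕ} (hn : n ≠ 0) (s t : ℝ) :
    ∑ x ∈ paduaIndex n, |paduaKernel n (s + nodeAngle n x.1) (t + nodeAngle (n + 1) x.2)| ≤
      2 * n * (n + 1) * (122 * logFactor n ^ 2) := by
  have hn1 : (1 : ℝ) ≤ n := by exact_mod_cast Nat.one_le_iff_ne_zero.2 hn
  calc _ ≤ ∑ x ∈ range (2 * n) ×ˢ range (2 * (n + 1)),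
          |paduaKernel n (s + nodeAngle n x.1) (t + nodeAngle (n + 1) x.2)| :=
        sum_le_sum_of_subset_of_nonneg (filter_subset _ _) fun _ _ _ => abs_nonneg _
    _ ≤ ∑ x ∈ range (2 * n) ×ˢ range (2 * (n + 1)),
          (|triangleKernel n (s + nodeAngle n x.1) (t + nodeAngle (n + 1) x.2)| + 1) :=
        sum_le_sum fun x _ => abs_paduaKernel_le hn _ _
    _ = ∑ j ∈ range (2 * n), ∑ k ∈ range (2 * (n + 1)),
          |triangleKernel n (s + nodeAngle n j) (t + nodeAngle (n + 1) k)| +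
        2 * n * (2 * (n + 1)) := by simp [sum_add_distrib, sum_product]
    _ ≤ 120 * ((n + 1) * logFactor n) ^ 2 + 2 * n * (2 * (n + 1)) := by
        gcongr; exact sum_abs_triangleKernel_le hn n.le_succ n.succ_ne_zero le_rfl s t
    _ ≤ 2 * n * (n + 1) * (122 * logFactor n ^ 2) := by
        have hL : 1 ≤ logFactor n ^ 2 := one_le_pow₀ (one_le_logFactor n)
        have hN : ((n : ℝ) + 1) ^ 2 ≤ 2 * n * (n + 1) := by nlinarith
        rw [mul_pow]
        nlinarith [mul_le_mul_of_nonneg_right hN (zero_le_one.trans hL),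
          mul_le_mul_of_nonneg_left hL (by positivity : (0 : ℝ) ≤ 2 * n * (n + 1))]

theorem abs_le_of_mem_cosSpan₂ {n : ℕ} (hn : n ≠ 0) {f : ℝ → ℝ → ℝ} (hf : f ∈ cosSpan₂ n) {M : ℝ}
    (hM : ∀ j k, Even (j + k) → |f (nodeAngle n j) (nodeAngle (n + 1) k)| ≤ M) (s t : ℝ) :
    |f s t| ≤ 122 * logFactor n ^ 2 * M := by
  have hpos : (0 : ℝ) < 2 * n * (n + 1) := by positivity
  have hM0 : 0 ≤ M := (abs_nonneg _).trans (hM 0 0 (by simp))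
  refine le_of_mul_le_mul_left ?_ hpos
  calc 2 * n * (n + 1) * |f s t| =
        |∑ x ∈ paduaIndex n, paduaKernel n (s + nodeAngle n x.1) (t + nodeAngle (n + 1) x.2) *
          f (nodeAngle n x.1) (nodeAngle (n + 1) x.2)| := by
        rw [sum_mul_paduaKernel hn hf, abs_mul, abs_of_pos hpos]
    _ ≤ (∑ x ∈ paduaIndex n,
          |paduaKernel n (s + nodeAngle n x.1) (t + nodeAngle (n + 1) x.2)|) * M :=
        abs_sum_mul_le _ fun x hx => hM _ _ (mem_filter.1 hx).2
    _ ≤ 2 * n * (n + 1) * (122 * logFactor n ^ 2) * M := by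
        gcongr; exact sum_abs_paduaKernel_le hn s t
    _ = 2 * n * (n + 1) * (122 * logFactor n ^ 2 * M) := mul_assoc _ _ _

/-! ### Polynomials in cosines -/

theorem cosSpan_mono {m n : ℕ} (h : m ≤ n) : cosSpan m ≤ cosSpan n :=
  Submodule.span_mono (Set.image_mono (Set.Iic_subset_Iic.2 h))

theorem cosSpan₂_mono {m n : ℕ} (h : m ≤ n) : cosSpan₂ m ≤ cosSpan₂ n :=
  Submodule.span_mono (Set.image_mono fun _ hx => mem_triangle.2 ((mem_triangle.1 hx).trans h))

theorem cos_nat_mul_mem_cosSpan {a n : ℕ} (h : a ≤ n) : (fun s : ℝ => cos (a * s)) ∈ cosSpan n :=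
  Submodule.subset_span ⟨a, h, rfl⟩

theorem cos_mul_mem_cosSpan {n : ℕ} {f : ℝ → ℝ} (hf : f ∈ cosSpan n) :
    cos * f ∈ cosSpan (n + 1) := by
  suffices h : cosSpan n ≤ (cosSpan (n + 1)).comap (LinearMap.mulLeft ℝ cos) from h hf
  refine Submodule.span_le.2 ?_
  rintro _ ⟨_ | a, ha, rfl⟩
  · simpa [Pi.mul_def] using cos_nat_mul_mem_cosSpan (Nat.le_add_left 1 n)
  · have hprod : cos * (fun s : ℝ => cos ((a + 1 : ℕ) * s)) =
        (1 / 2 : ℝ) • ((fun s => cos ((a + 2 : ℕ) * s)) + fun s => cos (a * s)) := by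
      ext s
      have hadd := cos_add ((a + 1 : ℕ) * s) s
      have hsub := cos_sub ((a + 1 : ℕ) * s) s
      rw [show (a + 1 : ℕ) * s + s = (a + 2 : ℕ) * s by push_cast; ring] at hadd
      rw [show (a + 1 : ℕ) * s - s = a * s by push_cast; ring] at hsub
      simp only [Pi.mul_apply, Pi.smul_apply, Pi.add_apply, smul_eq_mul]
      linear_combination -(1 / 2) * hadd - 1 / 2 * hsub
    rw [Set.mem_Iic] at ha
    simpa only [SetLike.mem_coe, Submodule.mem_comap, LinearMap.mulLeft_apply, hprod] using
      Submodule.smul_mem _ _ (add_mem (cos_nat_mul_mem_cosSpan (by omega))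
        (cos_nat_mul_mem_cosSpan (by omega)))

theorem cos_pow_mem_cosSpan (n : ℕ) : (fun s => cos s ^ n) ∈ cosSpan n := by
  induction n with
  | zero => simpa using cos_nat_mul_mem_cosSpan (Nat.zero_le 0)
  | succ n ih => simpa only [pow_succ', Pi.mul_def] using cos_mul_mem_cosSpan ih

theorem mul_mem_cosSpan₂ {m n : ℕ} {f g : ℝ → ℝ} (hf : f ∈ cosSpan m) (hg : g ∈ cosSpan n) :
    (fun s t => f s * g t) ∈ cosSpan₂ (m + n) := by
  let outerMul : (ℝ → ℝ) →ₗ[ℝ] (ℝ → ℝ) →ₗ[ℝ] (ℝ → ℝ → ℝ) :=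
    LinearMap.mk₂ ℝ (fun f g s t => f s * g t)
      (fun _ _ _ => by ext; simp [add_mul]) (fun _ _ _ => by ext; simp [mul_assoc])
      (fun _ _ _ => by ext; simp [mul_add]) (fun _ _ _ => by ext; simp [mul_left_comm])
  have hle : Submodule.map₂ outerMul (cosSpan m) (cosSpan n) ≤ cosSpan₂ (m + n) := by
    rw [cosSpan, cosSpan, Submodule.map₂_span_span]
    refine Submodule.span_mono ?_
    rintro _ ⟨_, ⟨a, ha, rfl⟩, _, ⟨b, hb, rfl⟩, rfl⟩
    exact ⟨(a, b), mem_triangle.2 (add_le_add ha hb), rfl⟩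
  exact hle (Submodule.apply_mem_map₂ outerMul hf hg)

theorem eval_update_cos_mem_cosSpan {σ : Type*} [Finite σ] [DecidableEq σ] {n : ℕ}
    {p : MvPolynomial σ ℝ} (hp : p ∈ MvPolynomial.restrictDegree σ ℝ n) (ω : σ → ℝ) (i : σ) :
    (fun s => MvPolynomial.eval (Function.update ω i (cos s)) p) ∈ cosSpan n := by
  have := Fintype.ofFinite σ
  have hsum : (fun s => MvPolynomial.eval (Function.update ω i (cos s)) p) =
      ∑ d ∈ p.support, (p.coeff d * ∏ j ∈ {i}ᶜ, ω j ^ d j) • fun s => cos s ^ d i := by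
    ext s
    have hprod (d : σ →₀ ℕ) : ∏ j ∈ {i}ᶜ, Function.update ω i (cos s) j ^ d j =
        ∏ j ∈ {i}ᶜ, ω j ^ d j := prod_congr rfl fun j hj => by
      rw [Function.update_of_ne (by simpa using hj)]
    simp only [MvPolynomial.eval_eq', Fintype.prod_eq_mul_prod_compl i, Function.update_self,
      hprod, Finset.sum_apply, Pi.smul_apply, smul_eq_mul, mul_comm (cos s ^ _), mul_assoc]
  rw [hsum]
  exact sum_mem fun d hd => Submodule.smul_mem _ _ (cosSpan_mono
    ((MvPolynomial.mem_restrictDegree _ _ _).1 hp d hd i) (cos_pow_mem_cosSpan (d i)))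

theorem eval_cos_mem_cosSpan₂ {n : ℕ} {p : MvPolynomial (Fin 2) ℝ} (hp : p ∈ totalDegreeSpace n) :
    (fun s t => MvPolynomial.eval ![cos s, cos t] p) ∈ cosSpan₂ n := by
  have hsum : (fun s t => MvPolynomial.eval ![cos s, cos t] p) =
      ∑ d ∈ p.support, p.coeff d • fun s t => cos s ^ d 0 * cos t ^ d 1 := by
    ext s t
    simp [MvPolynomial.eval_eq', Finset.sum_apply]
  rw [hsum]
  refine sum_mem fun d hd => Submodule.smul_mem _ _ (cosSpan₂_mono ?_
    (mul_mem_cosSpan₂ (cos_pow_mem_cosSpan (d 0)) (cos_pow_mem_cosSpan (d 1))))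
  have hdeg := (MvPolynomial.le_totalDegree hd).trans
    ((MvPolynomial.mem_restrictTotalDegree _ _ _).1 hp)
  rwa [Finsupp.sum_fintype _ _ (fun _ => rfl), Fin.sum_univ_two] at hdeg

/-! ### Chebyshev points and Padua points -/

theorem T_sq_add_one_sub_X_sq_mul_U_sq (R : Type*) [CommRing R] (n : ℤ) :
    Polynomial.Chebyshev.T R n ^ 2 +
      (1 - Polynomial.X ^ 2) * Polynomial.Chebyshev.U R (n - 1) ^ 2 = 1 := by
  have hstep (m : ℤ) : Polynomial.Chebyshev.T R (m + 1) ^ 2 +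
      (1 - Polynomial.X ^ 2) * Polynomial.Chebyshev.U R m ^ 2 = Polynomial.Chebyshev.T R m ^ 2 +
        (1 - Polynomial.X ^ 2) * Polynomial.Chebyshev.U R (m - 1) ^ 2 := by
    have hT := Polynomial.Chebyshev.T_eq_X_mul_T_sub_pol_U R (m - 1)
    have hU := Polynomial.Chebyshev.U_eq_X_mul_U_add_T R (m - 1)
    rw [show m - 1 + 2 = m + 1 by ring, sub_add_cancel] at hT
    rw [sub_add_cancel] at hU
    rw [hT, hU]
    ring
  induction n using Int.induction_on with
  | zero => simp
  | succ m ih =>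
    rw [add_sub_cancel_right]
    exact (hstep m).trans ih
  | pred m ih =>
    have h := hstep (-m - 1)
    rw [sub_add_cancel] at h
    exact h.symm.trans ih

theorem abs_eval_T_eq_one_iff (n : ℤ) (x : ℝ) : |(Polynomial.Chebyshev.T ℝ n).eval x| = 1 ↔
    |x| = 1 ∨ (Polynomial.Chebyshev.U ℝ (n - 1)).eval x = 0 := by
  have hpell := congrArg (Polynomial.eval x) (T_sq_add_one_sub_X_sq_mul_U_sq ℝ n)
  simp only [Polynomial.eval_add, Polynomial.eval_mul, Polynomial.eval_sub, Polynomial.eval_pow,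
    Polynomial.eval_one, Polynomial.eval_X] at hpell
  have habs (y : ℝ) : |y| = 1 ↔ 1 - y ^ 2 = 0 := by
    rw [sub_eq_zero, eq_comm (a := (1 : ℝ)), ← sq_abs,
      pow_eq_one_iff_of_nonneg (abs_nonneg y) two_ne_zero]
  rw [habs, habs, sub_eq_of_eq_add' hpell.symm, mul_eq_zero, sq_eq_zero_iff]

theorem eval_aeval_X {σ R : Type*} [CommSemiring R] (ω : σ → R) (i : σ) (q : Polynomial R) :
    MvPolynomial.eval ω (Polynomial.aeval (MvPolynomial.X i) q) = q.eval (ω i) := by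
  induction q using Polynomial.induction_on' with
  | add p q hp hq => simp [hp, hq]
  | monomial n a => simp [Polynomial.aeval_monomial]

theorem eval_pderiv_generatingPoly (n : ℕ) (ω : Fin 2 → ℝ) (d : Fin 2) :
    MvPolynomial.eval ω (MvPolynomial.pderiv d (generatingPoly n)) =
      ![n * (Polynomial.Chebyshev.U ℝ (n - 1)).eval (ω 0),
        -((n + 1) * (Polynomial.Chebyshev.U ℝ n).eval (ω 1))] d := by
  rw [generatingPoly, map_sub, Derivation.map_aeval, Derivation.map_aeval, map_sub, smul_eq_mul,
    smul_eq_mul, map_mul, map_mul, eval_aeval_X, eval_aeval_X,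
    Polynomial.Chebyshev.T_derivative_eq_U, Polynomial.Chebyshev.T_derivative_eq_U]
  fin_cases d <;> simp [MvPolynomial.pderiv_X]

theorem mem_paduaPoints_iff {n : ℕ} (hn : n ≠ 0) (ω : Square) : ω ∈ paduaPoints n ↔
    (Polynomial.Chebyshev.T ℝ n).eval (ω.1 0) =
        (Polynomial.Chebyshev.T ℝ (n + 1 : ℕ)).eval (ω.1 1) ∧
      |(Polynomial.Chebyshev.T ℝ n).eval (ω.1 0)| = 1 := by
  have hcurve : OnCurve n ω ↔ (Polynomial.Chebyshev.T ℝ n).eval (ω.1 0) =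
      (Polynomial.Chebyshev.T ℝ (n + 1 : ℕ)).eval (ω.1 1) := by
    rw [OnCurve, generatingPoly, map_sub, eval_aeval_X, eval_aeval_X, sub_eq_zero, Nat.cast_succ]
  have hsingular : IsSelfIntersection n ω ↔ OnCurve n ω ∧
      (Polynomial.Chebyshev.U ℝ (n - 1)).eval (ω.1 0) = 0 ∧
        (Polynomial.Chebyshev.U ℝ n).eval (ω.1 1) = 0 := by
    simp [IsSelfIntersection, Fin.forall_fin_two, eval_pderiv_generatingPoly, hn,
      Nat.cast_add_one_ne_zero]
  have hx := abs_eval_T_eq_one_iff n (ω.1 0)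
  have hy := abs_eval_T_eq_one_iff (n + 1 : ℕ) (ω.1 1)
  rw [Nat.cast_succ, add_sub_cancel_right] at hy
  rw [paduaPoints, Set.mem_ofPred_eq, IsBoundaryContact, Fin.exists_fin_two, hsingular, hcurve]
  grind

/-- The point of the square with angular coordinates `s` and `t`. -/
def squarePoint (s t : ℝ) : Square :=
  ⟨![cos s, cos t], by
    constructor <;> intro d <;> fin_cases d <;> simp [neg_one_le_cos, cos_le_one]⟩

theorem exists_eq_squarePoint (ω : Square) : ∃ s t, ω = squarePoint s t := by
  refine ⟨arccos (ω.1 0), arccos (ω.1 1), Subtype.ext (funext fun d => ?_)⟩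
  fin_cases d
  · simp [squarePoint, cos_arccos (ω.2.1 0) (ω.2.2 0)]
  · simp [squarePoint, cos_arccos (ω.2.1 1) (ω.2.2 1)]

theorem update_squarePoint_zero (s s' t : ℝ) :
    Function.update (squarePoint s t).1 0 (cos s') = squarePoint s' t :=
  funext (Fin.forall_fin_two.2 ⟨rfl, rfl⟩)

theorem update_squarePoint_one (s t t' : ℝ) :
    Function.update (squarePoint s t).1 1 (cos t') = squarePoint s t' :=
  funext (Fin.forall_fin_two.2 ⟨rfl, rfl⟩)

theorem eval_T_cos_nodeAngle {n : ℕ} (hn : n ≠ 0) (j : ℕ) :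
    (Polynomial.Chebyshev.T ℝ n).eval (cos (nodeAngle n j)) = (-1) ^ j := by
  rw [Polynomial.Chebyshev.T_real_cos, Int.cast_natCast, mul_nodeAngle hn, cos_nat_mul_pi]

theorem exists_cos_nodeAngle_eq {n : ℕ} (hn : n ≠ 0) {x : ℝ}
    (hx : |(Polynomial.Chebyshev.T ℝ n).eval x| = 1) : ∃ j ≤ n, x = cos (nodeAngle n j) :=
  (Polynomial.Chebyshev.abs_eval_T_real_eq_one_iff hn x).1 hx

theorem squarePoint_mem_paduaPoints_iff {n : ℕ} (hn : n ≠ 0) (j k : ℕ) :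
    squarePoint (nodeAngle n j) (nodeAngle (n + 1) k) ∈ paduaPoints n ↔ Even (j + k) := by
  rw [mem_paduaPoints_iff hn]
  simp only [squarePoint, Matrix.cons_val_zero, Matrix.cons_val_one, eval_T_cos_nodeAngle hn,
    eval_T_cos_nodeAngle n.succ_ne_zero, abs_neg_one_pow, and_true]
  rw [← neg_one_pow_eq_one_iff_even (R := ℝ) (by norm_num), pow_add]
  rcases neg_one_pow_eq_or ℝ j with hj | hj <;> rcases neg_one_pow_eq_or ℝ k with hk | hk <;>
    norm_num [hj, hk]

theorem squarePoint_mem_chebyshevGrid {n : ℕ} (hn : n ≠ 0) (j k : ℕ) :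
    squarePoint (nodeAngle n j) (nodeAngle n k) ∈ chebyshevGrid n := by
  have hnode (i : ℕ) : ∃ j ≤ n, cos (nodeAngle n i) = cos (nodeAngle n j) :=
    exists_cos_nodeAngle_eq hn (by rw [eval_T_cos_nodeAngle hn, abs_neg_one_pow])
  exact Fin.forall_fin_two.2 ⟨hnode j, hnode k⟩

theorem paduaPoints_subset {n : ℕ} (hn : n ≠ 0) : paduaPoints n ⊆
    (fun x : ℕ × ℕ => squarePoint (nodeAngle n x.1) (nodeAngle (n + 1) x.2)) ''
      ((range (n + 1) ×ˢ range (n + 2)).filter fun x => Even (x.1 + x.2)) := by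
  intro ω hω
  obtain ⟨hcurve, hx⟩ := (mem_paduaPoints_iff hn ω).1 hω
  obtain ⟨j, hj, hj0⟩ := exists_cos_nodeAngle_eq hn hx
  obtain ⟨k, hk, hk1⟩ := exists_cos_nodeAngle_eq n.succ_ne_zero (hcurve ▸ hx)
  have hωjk : squarePoint (nodeAngle n j) (nodeAngle (n + 1) k) = ω :=
    Subtype.ext (funext (Fin.forall_fin_two.2 ⟨hj0.symm, hk1.symm⟩))
  refine ⟨(j, k), ?_, hωjk⟩
  simp only [coe_filter, mem_product, mem_range, Set.mem_ofPred_eq]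
  exact ⟨⟨by omega, by omega⟩, (squarePoint_mem_paduaPoints_iff hn j k).1 (hωjk ▸ hω)⟩

theorem chebyshevGrid_subset (n : ℕ) : chebyshevGrid n ⊆
    (fun x : ℕ × ℕ => squarePoint (nodeAngle n x.1) (nodeAngle n x.2)) ''
      (range (n + 1) ×ˢ range (n + 1) : Finset (ℕ × ℕ)) := by
  intro ω hω
  obtain ⟨j, hj, hj0⟩ := hω 0
  obtain ⟨k, hk, hk1⟩ := hω 1
  refine ⟨(j, k), by simp; omega, Subtype.ext (funext (Fin.forall_fin_two.2 ?_))⟩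
  exact ⟨hj0.symm, hk1.symm⟩

/-! ### Dimensions -/

theorem finrank_restrictSupport {σ R : Type*} [CommSemiring R] [StrongRankCondition R]
    (S : Set (σ →₀ ℕ)) : Module.finrank R (MvPolynomial.restrictSupport R S) = S.ncard :=
  Module.finrank_eq_nat_card_basis (MvPolynomial.basisRestrictSupport R S)

/-- The pairs of exponents `(a, b)` of the monomials `x ^ a * y ^ b`. -/
def exponentEquiv : (Fin 2 →₀ ℕ) ≃ ℕ × ℕ := Finsupp.equivFunOnFinite.trans (finTwoArrowEquiv ℕ)

theorem ncard_preimage_exponentEquiv (A : Finset (ℕ × ℕ)) :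
    (exponentEquiv ⁻¹' A).ncard = #A := by
  rw [Set.ncard_preimage_of_injective_subset_range exponentEquiv.injective
    (by simp [exponentEquiv.surjective.range_eq]), Set.ncard_coe_finset]

theorem finrank_totalDegreeSpace (n : ℕ) :
    Module.finrank ℝ (totalDegreeSpace n) = #(triangle n) := by
  rw [totalDegreeSpace, MvPolynomial.restrictTotalDegree, finrank_restrictSupport,
    ← ncard_preimage_exponentEquiv]
  congr 1
  ext d
  simp [mem_triangle, exponentEquiv, Finsupp.sum_fintype]

theorem finrank_maximalDegreeSpace (n : ℕ) :
    Module.finrank ℝ (maximalDegreeSpace n) = #(range (n + 1) ×ˢ range (n + 1)) := by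
  rw [maximalDegreeSpace, MvPolynomial.restrictDegree, finrank_restrictSupport,
    ← ncard_preimage_exponentEquiv]
  congr 1
  ext d
  simp [exponentEquiv, Fin.forall_fin_two]

theorem two_mul_card_filter_of_involutive {α : Type*} {s : Finset α} {f : α → α}
    (hmaps : ∀ x ∈ s, f x ∈ s) (hinvol : ∀ x ∈ s, f (f x) = x) (p : α → Prop)
    [DecidablePred p] (hp : ∀ x ∈ s, (p (f x) ↔ ¬ p x)) : 2 * #(s.filter p) = #s := by
  have hcard : #(s.filter p) = #(s.filter fun x => ¬ p x) := by
    refine card_nbij' f f ?_ ?_ ?_ ?_ <;> intro x hx <;> obtain ⟨hxs, hpx⟩ := mem_filter.1 hx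
    · exact mem_filter.2 ⟨hmaps x hxs, by rwa [hp x hxs, not_not]⟩
    · exact mem_filter.2 ⟨hmaps x hxs, by rwa [hp x hxs]⟩
    all_goals exact hinvol x hxs
  rw [← card_filter_add_card_filter_not (s := s) p, ← hcard, two_mul]

theorem card_filter_even_eq_card_triangle (n : ℕ) :
    #((range (n + 1) ×ˢ range (n + 2)).filter fun x => Even (x.1 + x.2)) = #(triangle n) := by
  -- The central reflection of the box negates both conditions.
  have hhalf (p : ℕ × ℕ → Prop) [DecidablePred p]
      (hp : ∀ a ≤ n, ∀ b ≤ n + 1, (p (n - a, n + 1 - b) ↔ ¬ p (a, b))) :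
      2 * #((range (n + 1) ×ˢ range (n + 2)).filter p) = #(range (n + 1) ×ˢ range (n + 2)) := by
    refine two_mul_card_filter_of_involutive (f := fun x => (n - x.1, n + 1 - x.2)) ?_ ?_ p ?_ <;>
      simp only [Prod.forall, mem_product, mem_range, Prod.mk.injEq]
    · omega
    · omega
    · exact fun a b h => hp a (by omega) b (by omega)
  have heven := hhalf (fun x => Even (x.1 + x.2)) fun a ha b hb => by
    simp only [Nat.even_iff]; omega
  have htriangle := hhalf (fun x => x.1 + x.2 ≤ n) fun a ha b hb => by
    simp only; omega
  rw [triangle]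
  omega

/-! ### Near-best interpolation by polynomials -/

/-- `polyFun` as a linear map. -/
def polyFunₗ : MvPolynomial (Fin 2) ℝ →ₗ[ℝ] C(Square, ℝ) where
  toFun := polyFun
  map_add' p q := by ext ω; simp [polyFun]
  map_smul' c p := by ext ω; simp [polyFun]

theorem polyFunₗ_injective : Function.Injective polyFunₗ := by
  intro p q h
  refine MvPolynomial.funext_set (fun _ => Set.Icc (-1) 1)
    (fun _ => Set.Icc_infinite (by norm_num)) fun x hx => ?_
  exact DFunLike.congr_fun h ⟨x, fun i => (hx i trivial).1, fun i => (hx i trivial).2⟩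

theorem nearBest_of_isNormingSet {V : Submodule ℝ (MvPolynomial (Fin 2) ℝ)} [Module.Finite ℝ V]
    {X : Set Square} {A : Finset (ℕ × ℕ)} {node : ℕ × ℕ → Square} {Λ : ℝ}
    (hΛ : IsNormingSet (V.map polyFunₗ) X Λ) (hX : X ⊆ node '' A)
    (hA : #A = Module.finrank ℝ V) (α : C(Square, ℝ)) :
    (∃! p, IsInterpolant V X α p) ∧ (∃ q, IsBestApprox V α q) ∧
      ∀ p q, IsInterpolant V X α p → IsBestApprox V α q →
        ‖α - polyFun p‖ ≤ (1 + Λ) * ‖α - polyFun q‖ := by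
  have hfinite : (node '' A).Finite := A.finite_toSet.image node
  have hcard : X.ncard ≤ Module.finrank ℝ (V.map polyFunₗ) := by
    rw [← (V.equivMapOfInjective polyFunₗ polyFunₗ_injective).finrank_eq, ← hA,
      ← Set.ncard_coe_finset]
    exact (Set.ncard_le_ncard hX hfinite).trans (Set.ncard_image_le A.finite_toSet)
  refine ⟨?_, ?_, fun p q hp hq => hΛ.norm_sub_le ⟨p, hp.1, rfl⟩ ⟨q, hq.1, rfl⟩ hp.2⟩
  · obtain ⟨_, ⟨⟨p, hpV, rfl⟩, hp⟩, huniq⟩ :=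
      hΛ.existsUnique_interpolant (hfinite.subset hX) hcard α
    exact ⟨p, ⟨hpV, hp⟩, fun q hq =>
      polyFunₗ_injective (huniq (polyFunₗ q) ⟨⟨q, hq.1, rfl⟩, hq.2⟩)⟩
  · obtain ⟨_, ⟨q, hqV, rfl⟩, hq⟩ := exists_forall_norm_sub_le (V.map polyFunₗ) α
    exact ⟨q, hqV, fun r hr => hq _ ⟨r, hr, rfl⟩⟩

theorem isNormingSet_paduaPoints {n : ℕ} (hn : n ≠ 0) :
    IsNormingSet ((totalDegreeSpace n).map polyFunₗ) (paduaPoints n) (122 * logFactor n ^ 2) := by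
  rintro _ ⟨p, hp, rfl⟩ M hM
  have hnodes (j k : ℕ) (h : Even (j + k)) :
      |polyFun p (squarePoint (nodeAngle n j) (nodeAngle (n + 1) k))| ≤ M :=
    hM _ ((squarePoint_mem_paduaPoints_iff hn j k).2 h)
  have hM0 : 0 ≤ M := (abs_nonneg _).trans (hnodes 0 0 Even.zero)
  refine (ContinuousMap.norm_le _ (by positivity)).2 fun ω => ?_
  obtain ⟨s, t, rfl⟩ := exists_eq_squarePoint ω
  exact abs_le_of_mem_cosSpan₂ hn (eval_cos_mem_cosSpan₂ hp) hnodes s t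

theorem isNormingSet_chebyshevGrid {n : ℕ} (hn : n ≠ 0) :
    IsNormingSet ((maximalDegreeSpace n).map polyFunₗ) (chebyshevGrid n)
      ((11 * logFactor n) ^ 2) := by
  rintro _ ⟨p, hp, rfl⟩ M hM
  have hnodes (j k : ℕ) : |polyFun p (squarePoint (nodeAngle n j) (nodeAngle n k))| ≤ M :=
    hM _ (squarePoint_mem_chebyshevGrid hn j k)
  have hM0 : 0 ≤ M := (abs_nonneg _).trans (hnodes 0 0)
  refine (ContinuousMap.norm_le _ (by positivity)).2 fun ω => ?_
  obtain ⟨s, t, rfl⟩ := exists_eq_squarePoint ω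
  have hfst (t : ℝ) : (fun s => polyFun p (squarePoint s t)) ∈ cosSpan n := by
    simpa only [update_squarePoint_zero] using!
      eval_update_cos_mem_cosSpan hp (squarePoint 0 t).1 0
  have hsnd (s : ℝ) : (fun t => polyFun p (squarePoint s t)) ∈ cosSpan n := by
    simpa only [update_squarePoint_one] using!
      eval_update_cos_mem_cosSpan hp (squarePoint s 0).1 1
  rw [sq, mul_assoc]
  exact abs_le_of_mem_cosSpan hn (hfst t)
    (fun j => abs_le_of_mem_cosSpan hn (hsnd (nodeAngle n j)) (hnodes j) t) s

theorem logFactor_isBigO_log : logFactor =O[atTop] fun n : ℕ => log n := by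
  refine IsBigO.of_bound 3 ?_
  filter_upwards [eventually_ge_atTop 3] with n hn
  have hn' : (3 : ℝ) ≤ n := by exact_mod_cast hn
  have hone : 1 ≤ log n := by
    rw [le_log_iff_exp_le (by linarith)]
    linarith [exp_one_lt_d9]
  have hlog : log (2 * (n + 1)) ≤ 2 * log n := by
    rw [← Nat.cast_two, ← log_pow, Nat.cast_two]
    gcongr
    nlinarith
  rw [norm_of_nonneg (zero_le_one.trans (one_le_logFactor n)),
    norm_of_nonneg (zero_le_one.trans hone), logFactor]
  linarith

end NearBest

end

theorem mainTheorem2 :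
    (∃ ε : ℕ → ℝ, ε =O[atTop] (fun n : ℕ => Real.log (n : ℝ) ^ 2) ∧
      ∀ n : ℕ, 1 ≤ n → ∀ α : C(NearBest.Square, ℝ),
        (∃! p, NearBest.IsInterpolant (NearBest.totalDegreeSpace n) (NearBest.paduaPoints n) α p) ∧
        (∃ q, NearBest.IsBestApprox (NearBest.totalDegreeSpace n) α q) ∧
        ∀ p q,
          NearBest.IsInterpolant (NearBest.totalDegreeSpace n) (NearBest.paduaPoints n) α p →
          NearBest.IsBestApprox (NearBest.totalDegreeSpace n) α q →
          ‖α - NearBest.polyFun p‖ ≤ (1 + ε n) * ‖α - NearBest.polyFun q‖) ∧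
    (∃ ε : ℕ → ℝ, ε =O[atTop] (fun n : ℕ => Real.log (n : ℝ) ^ 2) ∧
      ∀ n : ℕ, 1 ≤ n → ∀ α : C(NearBest.Square, ℝ),
        (∃! p, NearBest.IsInterpolant (NearBest.maximalDegreeSpace n)
          (NearBest.chebyshevGrid n) α p) ∧
        (∃ q, NearBest.IsBestApprox (NearBest.maximalDegreeSpace n) α q) ∧
        ∀ p q,
          NearBest.IsInterpolant (NearBest.maximalDegreeSpace n) (NearBest.chebyshevGrid n) α p →
          NearBest.IsBestApprox (NearBest.maximalDegreeSpace n) α q →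
          ‖α - NearBest.polyFun p‖ ≤ (1 + ε n) * ‖α - NearBest.polyFun q‖) := by
  refine ⟨⟨fun n => 122 * NearBest.logFactor n ^ 2,
      (NearBest.logFactor_isBigO_log.pow 2).const_mul_left 122, fun n hn => ?_⟩,
    ⟨fun n => (11 * NearBest.logFactor n) ^ 2,
      (NearBest.logFactor_isBigO_log.const_mul_left 11).pow 2, fun n hn => ?_⟩⟩
  · have hn0 : n ≠ 0 := Nat.one_le_iff_ne_zero.1 hn
    exact NearBest.nearBest_of_isNormingSet (NearBest.isNormingSet_paduaPoints hn0)
      (NearBest.paduaPoints_subset hn0) (by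
        rw [NearBest.finrank_totalDegreeSpace, NearBest.card_filter_even_eq_card_triangle])
  · exact NearBest.nearBest_of_isNormingSet
      (NearBest.isNormingSet_chebyshevGrid (Nat.one_le_iff_ne_zero.1 hn))
      (NearBest.chebyshevGrid_subset n) (NearBest.finrank_maximalDegreeSpace n).symm
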